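/- Let $\mathbf{k}$ be a commutative ring, let $n\ge 0$ be an integer, and let $\mathbf{k}[S_n]$ be the group algebra of the symmetric group $S_n$ over $\mathbf{k}$, with multiplication $(\sigma\tau)(i)=\sigma(\tau(i))$. For $w\in S_n$ let $\operatorname{Des} w=\{i\in\{1,\dots,n-1\} : w(i)>w(i+1)\}$, and for $I\subseteq\{1,\dots,n-1\}$ let $B_I=\sum_{w\in S_n,\ \operatorname{Des}w\subseteq I} w\in\mathbf{k}[S_n]$. Let $\mathcal{D}_n\subseteq\mathbf{k}[S_n]$ (the descent algebra) be the $\mathbf{k}$-linear span of all the $B_I$. For a composition $\alpha=(\alpha_1,\dots,\alpha_k)$ of $n$ (a tuple of positive integers with sum $n$) let $B_\alpha=B_I$ with $I=\{\alpha_1,\ \alpha_1+\alpha_2,\ \dots,\ \alpha_1+\cdots+\alpha_{k-1}\}$. Let $w_0\in S_n$ be the permutation $i\mapsto n+1-i$. A face is a tuple $F=(F_1,\dots,F_m)$ of nonempty, pairwise disjoint sets with union $\{1,\dots,n\}$; its type is the composition $(|F_1|,\dots,|F_m|)$ of $n$. A face $F$ is contained in a face $G$ if every block $F_i$ is a subset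 of some block $G_j$. Let $\mathcal{F}$ be the set of all faces. The knapsack number $n_\alpha(F)$ is the number of faces $G$ of type $\alpha$ such that $F$ is contained in $G$, and $n_\alpha(\mathcal{F})=\{n_\alpha(F) : F\in\mathcal{F}\}$. **Theorem.** For every composition $\alpha$ of $n$, the element $w_0B_\alpha$ belongs to $\mathcal{D}_n$ and is annihilated by the polynomial $$x\prod_{\substack{k\in n_\alpha(\mathcal{F})\\ k\neq 0}}(x+k)(x-k)\in\mathbf{k}[x],$$ that is, $$w_0B_\alpha\prod_{\substack{k\in n_\alpha(\mathcal{F})\\ k\neq 0}}(w_0B_\alpha+k)(w_0B_\alpha-k)=0.$$ Here the product ranges over the distinct nonzero integers $k$ in $n_\alpha(\mathcal{F})$. -/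

import Mathlib

/-- A set composition (or face) of an `n`-element set, modelled by `Fin n`: an ordered tuple of
nonempty, pairwise disjoint sets whose union is everything. -/
@[ext]
structure SetComposition (n : ℕ) where
  /-- The blocks, in order. -/
  blocks : List (Finset (Fin n))
  nonempty_of_mem : ∀ B ∈ blocks, B.Nonempty
  pairwise_disjoint : blocks.Pairwise Disjoint
  exists_mem : ∀ i : Fin n, ∃ B ∈ blocks, i ∈ B

namespace SetComposition

instance instDecidableEqSetComposition (n : ℕ) : DecidableEq (SetComposition n) :=
  fun F G => decidable_of_iff (F.blocks = G.blocks) SetComposition.ext_iff.symm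

theorem nodup_blocks {n : ℕ} (F : SetComposition n) : F.blocks.Nodup := by
  refine List.Pairwise.imp_of_mem ?_ F.pairwise_disjoint
  intro A B hA _ hAB h
  subst h
  exact (F.nonempty_of_mem A hA).ne_empty (disjoint_self.mp hAB)

instance instFintypeSetComposition (n : ℕ) : Fintype (SetComposition n) :=
  Fintype.ofEquiv
    {l : {l : List (Finset (Fin n)) // l.Nodup} //
      (∀ B ∈ l.1, B.Nonempty) ∧ l.1.Pairwise Disjoint ∧ ∀ i : Fin n, ∃ B ∈ l.1, i ∈ B}
    { toFun := fun l => ⟨l.1.1, l.2.1, l.2.2.1, l.2.2.2⟩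
      invFun := fun F => ⟨⟨F.blocks, F.nodup_blocks⟩,
        F.nonempty_of_mem, F.pairwise_disjoint, F.exists_mem⟩
      left_inv := fun _ => rfl
      right_inv := fun _ => rfl }

theorem sum_map_card {n : ℕ} (l : List (Finset (Fin n))) (hl : l.Pairwise Disjoint) :
    (l.map Finset.card).sum = (l.foldr (· ∪ ·) ∅).card ∧
      ∀ i : Fin n, i ∈ l.foldr (· ∪ ·) ∅ ↔ ∃ B ∈ l, i ∈ B := by
  induction l with
  | nil => simp
  | cons A l ih =>
    rw [List.pairwise_cons] at hl
    obtain ⟨h1, h2⟩ := ih hl.2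
    refine ⟨?_, fun i => by simp [h2]⟩
    have hd : Disjoint A (l.foldr (· ∪ ·) ∅) := by
      rw [Finset.disjoint_left]
      intro i hi hi'
      obtain ⟨B, hB, hiB⟩ := (h2 i).mp hi'
      exact Finset.disjoint_left.mp (hl.1 B hB) hi hiB
    simp [Finset.card_union_of_disjoint hd, h1]

/-- The type of a set composition: the composition of `n` formed by the sizes of the blocks. -/
def type {n : ℕ} (F : SetComposition n) : Composition n where
  blocks := F.blocks.map Finset.card
  blocks_pos := by
    intro i hi
    obtain ⟨B, hB, rfl⟩ := List.mem_map.mp hi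
    exact (F.nonempty_of_mem B hB).card_pos
  blocks_sum := by
    obtain ⟨h1, h2⟩ := sum_map_card F.blocks F.pairwise_disjoint
    rw [h1, Finset.eq_univ_iff_forall.mpr fun i => (h2 i).mpr (F.exists_mem i)]
    simp

/-- `F` is contained in `G`: every block of `F` is a subset of a block of `G`. -/
def IsContainedIn {n : ℕ} (F G : SetComposition n) : Prop :=
  ∀ A ∈ F.blocks, ∃ B ∈ G.blocks, A ⊆ B

instance instDecidableIsContainedIn {n : ℕ} (F G : SetComposition n) :
    Decidable (F.IsContainedIn G) :=
  inferInstanceAs (Decidable (∀ A ∈ F.blocks, ∃ B ∈ G.blocks, A ⊆ B))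

end SetComposition

/-- The knapsack number `n_α(F)`: the number of faces `G` of type `α` such that `F` is contained
in `G`. -/
def knapsackNumber {n : ℕ} (α : Composition n) (F : SetComposition n) : ℕ :=
  (Finset.univ.filter fun G : SetComposition n => F.IsContainedIn G ∧ G.type = α).card

/-- The set of the (distinct) knapsack numbers `n_α(F)` of all faces `F`. -/
def knapsackNumbers {n : ℕ} (α : Composition n) : Finset ℕ :=
  Finset.univ.image (knapsackNumber α)

/-- The descent set of `w`, as a subset of `{1, …, n - 1}`. The positions `1, …, n` are modelled by
`Fin n`, so that the `d`-th position is the element of `Fin n` of value `d - 1`; hence `d` is a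
descent if `w` is larger at the element of value `d - 1` than at the element of value `d`. -/
def descentSet {n : ℕ} (w : Equiv.Perm (Fin n)) : Finset ℕ :=
  (Finset.Icc 1 (n - 1)).filter fun d =>
    ∃ i j : Fin n, (i : ℕ) + 1 = d ∧ (j : ℕ) = d ∧ w j < w i

/-- The subset `{α₁, α₁ + α₂, …, α₁ + ⋯ + α_{k-1}}` of `{1, …, n - 1}` that corresponds to the
composition `α = (α₁, …, α_k)` of `n`, i.e. the set whose consecutive gaps (with `0` and `n`
adjoined) are `α₁, …, α_k`. -/
def partialSums {n : ℕ} (α : Composition n) : Finset ℕ :=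
  (Finset.Ico 1 α.length).image α.sizeUpTo

/-- The element `B_I` of the group algebra of the symmetric group: the sum of all permutations
whose descent set is contained in `I`. -/
noncomputable def descentB (k : Type*) [CommRing k] (n : ℕ) (I : Finset ℕ) :
    MonoidAlgebra k (Equiv.Perm (Fin n)) :=
  ∑ w ∈ Finset.univ.filter (fun w : Equiv.Perm (Fin n) => descentSet w ⊆ I),
    MonoidAlgebra.of k (Equiv.Perm (Fin n)) w

/-- The element `B_α`, for a composition `α` of `n`. -/
noncomputable def compositionB (k : Type*) [CommRing k] {n : ℕ} (α : Composition n) :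
    MonoidAlgebra k (Equiv.Perm (Fin n)) :=
  descentB k n (partialSums α)

/-- The descent algebra, as the `k`-linear span of the `B_I` for all `I ⊆ {1, …, n - 1}`. -/
noncomputable def descentAlgebra (k : Type*) [CommRing k] (n : ℕ) :
    Submodule k (MonoidAlgebra k (Equiv.Perm (Fin n))) :=
  Submodule.span k (descentB k n '' {I : Finset ℕ | I ⊆ Finset.Icc 1 (n - 1)})

/-- The permutation `w₀`, with one-line notation `(n, n - 1, …, 1)`, in the group algebra. -/
noncomputable def longestElement (k : Type*) [CommRing k] (n : ℕ) :
    MonoidAlgebra k (Equiv.Perm (Fin n)) :=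
  MonoidAlgebra.of k (Equiv.Perm (Fin n)) Fin.revPerm

/-- The polynomial `x ∏ (x + m) (x - m)`, the product ranging over the distinct nonzero knapsack
numbers `m` with respect to `α`. -/
noncomputable def knapsackPolynomial (k : Type*) [CommRing k] {n : ℕ} (α : Composition n) :
    Polynomial k :=
  Polynomial.X * ∏ m ∈ (knapsackNumbers α).filter (fun m => m ≠ 0),
    ((Polynomial.X + Polynomial.C (m : k)) * (Polynomial.X - Polynomial.C (m : k)))

/-! The proof passes to the face monoid. Permutations embed as total orders ("chambers"), and right
multiplication by `B_α` becomes left multiplication by the sum `B` of all faces of type `α`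
(`chamberMap_mul_compositionB`), while right multiplication by `w₀` becomes reversal of orders. With
`B'` the reversal of `B`, the square of `w₀B_α` therefore acts as `BB'`. The knapsack polynomial is
`Q(x²)·x` with `Q` the product of the `x - m²`, so it suffices that `B·Q(B'B) = 0`. Right
multiplication by a face `G` fixes `F` if `G` is coarser than `F`, and otherwise gives a face with
strictly more coarsenings of `G`'s type. Hence on faces with at least `m` coarsenings of type `α`,
both `B` and `B'` act as `m` modulo faces with more, and `B'B` acts as `m²`. Since `B` starts at
level 1, the factors of `Q` push it up past every level (`mul_aeval_eq_zero_of_mem_layer`).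
Membership in the descent algebra is a separate inclusion-exclusion over descent sets. -/

/-! ### The monoid of relations under the lexicographic product. -/

/-- Relations on `Fin n`, thought of as strict orders and multiplied lexicographically. -/
def LexRel (n : ℕ) : Type := Fin n → Fin n → Prop

namespace LexRel

variable {n : ℕ}

@[ext]
theorem ext {F G : LexRel n} (h : ∀ i j, F i j ↔ G i j) : F = G :=
  funext fun i => funext fun j => propext (h i j)

/-- The monoid laws are propositional tautologies in the truth values at `(i, j)` and `(j, i)`, so
no order axioms are needed. -/
instance : Monoid (LexRel n) where
  mul F G := fun i j => F i j ∨ (¬ F j i ∧ G i j)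
  one := fun _ _ => False
  mul_assoc F G H := by
    ext i j
    change (F i j ∨ (¬ F j i ∧ G i j)) ∨ (¬ (F j i ∨ (¬ F i j ∧ G j i)) ∧ H i j) ↔
      F i j ∨ (¬ F j i ∧ (G i j ∨ (¬ G j i ∧ H i j)))
    tauto
  one_mul F := by
    ext i j
    change False ∨ (¬ False ∧ F i j) ↔ F i j
    tauto
  mul_one F := by
    ext i j
    change F i j ∨ (¬ F j i ∧ False) ↔ F i j
    tauto

theorem mul_apply (F G : LexRel n) (i j : Fin n) :
    (F * G) i j ↔ F i j ∨ (¬ F j i ∧ G i j) :=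
  Iff.rfl

/-- Reversal of relations. -/
def rev : LexRel n →* LexRel n where
  toFun F := fun i j => F j i
  map_one' := rfl
  map_mul' _ _ := rfl

theorem rev_apply (F : LexRel n) (i j : Fin n) : rev F i j ↔ F j i :=
  Iff.rfl

/-- The weak order on `Fin n` pulled back along a map. -/
def ofMap {m : ℕ} (f : Fin n → Fin m) : LexRel n := fun i j => f i < f j

theorem ofMap_apply {m : ℕ} (f : Fin n → Fin m) (i j : Fin n) : ofMap f i j ↔ f i < f j :=
  Iff.rfl

/-- Two elements that are not related either way. -/
def Incomp (F : LexRel n) (i j : Fin n) : Prop := ¬ F i j ∧ ¬ F j i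

theorem Incomp.symm {F : LexRel n} {i j : Fin n} (h : F.Incomp i j) : F.Incomp j i :=
  ⟨h.2, h.1⟩

theorem incomp_mul (F G : LexRel n) (i j : Fin n) :
    (F * G).Incomp i j ↔ F.Incomp i j ∧ G.Incomp i j := by
  simp only [Incomp, mul_apply]
  tauto

theorem incomp_rev (F : LexRel n) (i j : Fin n) : (rev F).Incomp i j ↔ F.Incomp i j := by
  simp only [Incomp, rev_apply]
  tauto

theorem incomp_ofMap {m : ℕ} (f : Fin n → Fin m) (i j : Fin n) :
    (ofMap f).Incomp i j ↔ f i = f j := by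
  simp only [Incomp, ofMap_apply, not_lt]
  exact ⟨fun h => le_antisymm h.2 h.1, fun h => ⟨h.ge, h.le⟩⟩

/-- A relation is weak if incomparability is an equivalence relation. -/
def IsWeak (F : LexRel n) : Prop := Equivalence F.Incomp

theorem IsWeak.mul {F G : LexRel n} (hF : F.IsWeak) (hG : G.IsWeak) : (F * G).IsWeak where
  refl i := (incomp_mul F G i i).2 ⟨hF.refl i, hG.refl i⟩
  symm h := h.symm
  trans h h' := by
    rw [incomp_mul] at *
    exact ⟨hF.trans h.1 h'.1, hG.trans h.2 h'.2⟩

theorem isWeak_ofMap {m : ℕ} (f : Fin n → Fin m) : (ofMap f).IsWeak where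
  refl i := (incomp_ofMap f i i).2 rfl
  symm h := h.symm
  trans h h' := by
    rw [incomp_ofMap] at *
    exact h.trans h'

/-- Ties left by `F` are ties of `G` too, so `G` never gets to decide anything. -/
theorem mul_eq_left_of_incomp {F G : LexRel n} (h : ∀ i j, F.Incomp i j → G.Incomp i j) :
    F * G = F := by
  ext i j
  have := h i j
  simp only [Incomp, mul_apply] at *
  tauto

end LexRel

/-! ### Faces as maps, and knapsack numbers as coarsening numbers. -/

/-- The maps `Fin n → Fin α.length` whose fibres have the sizes prescribed by `α`. -/
def typeMaps {n : ℕ} (α : Composition n) : Finset (Fin n → Fin α.length) :=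
  Finset.univ.filter fun f => ∀ c, (Finset.univ.filter fun i => f i = c).card = α.blocksFun c

open Classical in
/-- The number of faces of type `α` containing a given relation. -/
noncomputable def coarseningNumber {n : ℕ} (α : Composition n) (F : LexRel n) : ℕ :=
  ((typeMaps α).filter fun f => ∀ i j, F.Incomp i j → f i = f j).card

/-- The product refines both factors, so it keeps all coarsenings of `F` and gains `f`. -/
theorem coarseningNumber_lt_mul {n : ℕ} {α : Composition n} {F G : LexRel n}
    {f : Fin n → Fin α.length} (hf : f ∈ typeMaps α) (hFf : ¬ ∀ i j, F.Incomp i j → f i = f j)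
    (hG : ∀ i j, G.Incomp i j → f i = f j) :
    coarseningNumber α F < coarseningNumber α (F * G) := by
  classical
  refine Finset.card_lt_card ((Finset.ssubset_iff_of_subset fun g hg => ?_).2 ⟨f, ?_, ?_⟩)
  · simp only [Finset.mem_filter] at hg ⊢
    exact ⟨hg.1, fun i j h => hg.2 i j ((F.incomp_mul G i j).1 h).1⟩
  · simp only [Finset.mem_filter]
    exact ⟨hf, fun i j h => hG i j ((F.incomp_mul G i j).1 h).2⟩
  · simp only [Finset.mem_filter, not_and]
    exact fun _ => hFf

namespace SetComposition

variable {n : ℕ}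

/-- The set composition formed by the fibres of a surjective map to `Fin m`. -/
def ofMap {m : ℕ} (f : Fin n → Fin m) (hf : Function.Surjective f) : SetComposition n where
  blocks := List.ofFn fun c => Finset.univ.filter fun i => f i = c
  nonempty_of_mem := by
    intro B hB
    obtain ⟨c, rfl⟩ := (List.mem_ofFn' _ _).1 hB
    obtain ⟨i, hi⟩ := hf c
    exact ⟨i, by simp [hi]⟩
  pairwise_disjoint := by
    rw [List.pairwise_ofFn]
    intro c d hcd
    rw [Finset.disjoint_left]
    intro i hi hi'
    simp only [Finset.mem_filter, Finset.mem_univ, true_and] at hi hi'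
    exact hcd.ne (hi.symm.trans hi')
  exists_mem i := ⟨_, (List.mem_ofFn' _ _).2 ⟨f i, rfl⟩, by simp⟩

theorem exists_map (G : SetComposition n) :
    ∃ f : Fin n → Fin G.blocks.length, ∀ i c, f i = c ↔ i ∈ G.blocks.get c := by
  have h : ∀ i, ∃ c, i ∈ G.blocks.get c := fun i => by
    obtain ⟨B, hB, hi⟩ := G.exists_mem i
    obtain ⟨c, rfl⟩ := List.mem_iff_get.1 hB
    exact ⟨c, hi⟩
  choose f hf using h
  refine ⟨f, fun i c => ⟨fun h => h ▸ hf i, fun h => ?_⟩⟩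
  by_contra hne
  have hd : Disjoint (G.blocks.get (f i)) (G.blocks.get c) := by
    rcases lt_or_gt_of_ne hne with hlt | hlt
    · exact List.pairwise_iff_get.1 G.pairwise_disjoint _ _ hlt
    · exact (List.pairwise_iff_get.1 G.pairwise_disjoint _ _ hlt).symm
  exact Finset.disjoint_left.1 hd (hf i) h

/-- The set composition formed by the classes of an equivalence relation, in some order. -/
theorem exists_of_equivalence {r : Fin n → Fin n → Prop} (hr : Equivalence r) :
    ∃ S : SetComposition n, ∀ i j, (∃ A ∈ S.blocks, i ∈ A ∧ j ∈ A) ↔ r i j := by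
  classical
  let P : Fin n → Finset (Fin n) := fun i => Finset.univ.filter fun j => r i j
  have hP : ∀ i j, j ∈ P i ↔ r i j := fun i j => by simp [P]
  have hmem : ∀ A, A ∈ (Finset.univ.image P).toList ↔ ∃ i, P i = A := fun A => by simp
  refine ⟨⟨(Finset.univ.image P).toList, ?_, ?_, ?_⟩, ?_⟩
  · intro B hB
    obtain ⟨i, rfl⟩ := (hmem B).1 hB
    exact ⟨i, (hP i i).2 (hr.refl i)⟩
  · refine List.Pairwise.imp_of_mem ?_ (Finset.nodup_toList _)
    intro A B hA hB hAB
    obtain ⟨i, rfl⟩ := (hmem A).1 hA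
    obtain ⟨j, rfl⟩ := (hmem B).1 hB
    rw [Finset.disjoint_left]
    intro x hx hx'
    rw [hP] at hx hx'
    refine hAB (Finset.ext fun y => ?_)
    rw [hP, hP]
    have hij := hr.trans hx (hr.symm hx')
    exact ⟨fun h => hr.trans (hr.symm hij) h, fun h => hr.trans hij h⟩
  · exact fun i => ⟨P i, (hmem _).2 ⟨i, rfl⟩, (hP i i).2 (hr.refl i)⟩
  · intro i j
    constructor
    · rintro ⟨A, hA, hi, hj⟩
      obtain ⟨x, rfl⟩ := (hmem A).1 hA
      rw [hP] at hi hj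
      exact hr.trans (hr.symm hi) hj
    · exact fun h => ⟨P i, (hmem _).2 ⟨i, rfl⟩, (hP i i).2 (hr.refl i), (hP i j).2 h⟩

end SetComposition

theorem surjective_of_mem_typeMaps {n : ℕ} {α : Composition n} {f : Fin n → Fin α.length}
    (hf : f ∈ typeMaps α) : Function.Surjective f := by
  intro c
  have h : 0 < (Finset.univ.filter fun i => f i = c).card := by
    rw [(Finset.mem_filter.1 hf).2 c]
    exact α.one_le_blocksFun c
  obtain ⟨i, hi⟩ := Finset.card_pos.1 h
  exact ⟨i, (Finset.mem_filter.1 hi).2⟩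

/-- A face is the same as the map sending each element to the index of its block. -/
theorem knapsackNumber_eq_card {n : ℕ} (α : Composition n) (S : SetComposition n) :
    knapsackNumber α S = ((typeMaps α).filter fun f =>
      ∀ A ∈ S.blocks, ∀ i ∈ A, ∀ j ∈ A, f i = f j).card := by
  symm
  refine Finset.card_bij
    (fun f hf => SetComposition.ofMap f (surjective_of_mem_typeMaps (Finset.mem_filter.1 hf).1))
    ?_ ?_ ?_
  · intro f hf
    obtain ⟨hf, hS⟩ := Finset.mem_filter.1 hf
    refine Finset.mem_filter.2 ⟨Finset.mem_univ _, fun A hA => ?_, ?_⟩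
    · obtain ⟨i, hi⟩ := S.nonempty_of_mem A hA
      refine ⟨_, (List.mem_ofFn' _ _).2 ⟨f i, rfl⟩, fun j hj => ?_⟩
      simpa using hS A hA j hj i hi
    · apply Composition.ext
      change List.map Finset.card (List.ofFn _) = _
      rw [List.map_ofFn, ← α.ofFn_blocksFun]
      exact congrArg List.ofFn (funext (Finset.mem_filter.1 hf).2)
  · intro f hf g hg h
    have h' := List.ofFn_injective (congrArg SetComposition.blocks h)
    funext i
    have : i ∈ Finset.univ.filter fun j => g j = f i := by
      rw [← congrFun h' (f i)]
      simp
    exact (Finset.mem_filter.1 this).2.symm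
  · rintro G hG
    obtain ⟨-, hSG, rfl⟩ := Finset.mem_filter.1 hG
    have hlen : G.type.length = G.blocks.length := List.length_map _
    obtain ⟨f, hf⟩ := G.exists_map
    have hfib : ∀ c, (Finset.univ.filter fun i => f i = c) = G.blocks.get c := fun c => by
      ext i
      simp [hf]
    refine ⟨fun i => Fin.cast hlen.symm (f i), ?_, ?_⟩
    · refine Finset.mem_filter.2 ⟨Finset.mem_filter.2 ⟨Finset.mem_univ _, fun c => ?_⟩, ?_⟩
      · have : (Finset.univ.filter fun i => Fin.cast hlen.symm (f i) = c) =
            G.blocks.get (Fin.cast hlen c) := by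
          rw [← hfib]
          ext i
          simp [Fin.ext_iff]
        rw [this]
        exact (List.getElem_map Finset.card).symm
      · intro A hA i hi j hj
        obtain ⟨B, hB, hAB⟩ := hSG A hA
        obtain ⟨c, rfl⟩ := List.mem_iff_get.1 hB
        exact congrArg _ (((hf i c).2 (hAB hi)).trans ((hf j c).2 (hAB hj)).symm)
    · apply SetComposition.ext
      change List.ofFn _ = _
      refine List.ext_get (by simp [hlen]) fun m h1 h2 => ?_
      rw [← hfib, List.get_ofFn]
      ext i
      simp [Fin.ext_iff]

/-- Containment ignores the order of the blocks of the smaller face, so the incomparability classes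
may be listed arbitrarily. -/
theorem coarseningNumber_mem_knapsackNumbers {n : ℕ} (α : Composition n) {F : LexRel n}
    (hF : F.IsWeak) : coarseningNumber α F ∈ knapsackNumbers α := by
  classical
  obtain ⟨S, hS⟩ := SetComposition.exists_of_equivalence hF
  refine Finset.mem_image.2 ⟨S, Finset.mem_univ _, ?_⟩
  rw [knapsackNumber_eq_card, coarseningNumber]
  refine congrArg Finset.card (Finset.filter_congr fun f _ => ?_)
  simp only [← hS]
  exact ⟨fun h i j ⟨A, hA, hi, hj⟩ => h A hA i hi j hj,
    fun h A hA i hi j hj => h i j ⟨A, hA, hi, hj⟩⟩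

/-! ### The filtration by coarsening number and the annihilation in the face algebra. -/

section FaceAlgebra

variable (k : Type*) [CommRing k] {n : ℕ} (α : Composition n)

/-- The sum of all faces of type `α`, in the algebra of lexicographically multiplied relations. -/
noncomputable def faceSum : MonoidAlgebra k (LexRel n) :=
  ∑ f ∈ typeMaps α, MonoidAlgebra.single (LexRel.ofMap f) 1

/-- The sum of the reversals of all faces of type `α`. -/
noncomputable def faceSumRev : MonoidAlgebra k (LexRel n) :=
  ∑ f ∈ typeMaps α, MonoidAlgebra.single (LexRel.rev (LexRel.ofMap f)) 1

/-- The span of the weak relations that are contained in at least `m` faces of type `α`. -/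
noncomputable def layer (m : ℕ) : Submodule k (MonoidAlgebra k (LexRel n)) :=
  Submodule.span k {x | ∃ F : LexRel n, F.IsWeak ∧ m ≤ coarseningNumber α F ∧
    MonoidAlgebra.single F 1 = x}

variable {k α}

theorem single_mem_layer {m : ℕ} {F : LexRel n} (hF : F.IsWeak) (h : m ≤ coarseningNumber α F) :
    MonoidAlgebra.single F (1 : k) ∈ layer k α m :=
  Submodule.subset_span ⟨F, hF, h, rfl⟩

theorem layer_antitone : Antitone (layer k α) := fun _ _ h =>
  Submodule.span_mono fun _ ⟨F, hF, hm, hx⟩ => ⟨F, hF, h.trans hm, hx⟩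

theorem layer_succ_of_notMem {m : ℕ} (hm : m ∉ knapsackNumbers α) :
    layer k α m = layer k α (m + 1) := by
  refine le_antisymm (Submodule.span_mono ?_) (layer_antitone (Nat.le_succ m))
  rintro x ⟨F, hF, h, rfl⟩
  refine ⟨F, hF, Nat.succ_le_of_lt (lt_of_le_of_ne h ?_), rfl⟩
  rintro rfl
  exact hm (coarseningNumber_mem_knapsackNumbers α hF)

theorem layer_eq_bot {m : ℕ} (hm : ∀ j ∈ knapsackNumbers α, j < m) : layer k α m = ⊥ := by
  rw [layer, Submodule.span_eq_bot]
  rintro x ⟨F, hF, h, rfl⟩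
  exact absurd (hm _ (coarseningNumber_mem_knapsackNumbers α hF)) h.not_gt

/-- Only the ties of `G f` matter, so one argument covers faces and their reversals. -/
theorem mul_sum_sub_mem_layer {G : (Fin n → Fin α.length) → LexRel n}
    (hG : ∀ f i j, (G f).Incomp i j ↔ f i = f j) {m : ℕ} {v : MonoidAlgebra k (LexRel n)}
    (hv : v ∈ layer k α m) :
    v * (∑ f ∈ typeMaps α, MonoidAlgebra.single (G f) 1) - m • v ∈ layer k α (m + 1) := by
  classical
  induction hv using Submodule.span_induction with
  | zero => simp
  | add x y _ _ hx hy =>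
    rw [add_mul, smul_add, add_sub_add_comm]
    exact add_mem hx hy
  | smul c x _ hx =>
    rw [smul_mul_assoc, smul_comm, ← smul_sub]
    exact Submodule.smul_mem _ c hx
  | mem x hx =>
    obtain ⟨F, hF, hm, rfl⟩ := hx
    have hweak : ∀ f, (G f).IsWeak := fun f =>
      ⟨fun i => (hG f i i).2 rfl, fun h => h.symm, fun h h' =>
        (hG f _ _).2 (((hG f _ _).1 h).trans ((hG f _ _).1 h'))⟩
    -- Each `f` coarser than `F` contributes `F` itself; every other `f` contributes a term of a
    -- higher layer.
    rw [Finset.mul_sum, ← Finset.sum_filter_add_sum_filter_not (typeMaps α)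
      (fun f => ∀ i j, F.Incomp i j → f i = f j), add_sub_right_comm]
    refine add_mem ?_ (Submodule.sum_mem _ fun f hf => ?_)
    · have h : ∀ f ∈ (typeMaps α).filter fun f => ∀ i j, F.Incomp i j → f i = f j,
          MonoidAlgebra.single F (1 : k) * MonoidAlgebra.single (G f) 1 =
            MonoidAlgebra.single F 1 := fun f hf => by
        rw [MonoidAlgebra.single_mul_single, mul_one, LexRel.mul_eq_left_of_incomp]
        exact fun i j h => (hG f i j).2 ((Finset.mem_filter.1 hf).2 i j h)
      rw [Finset.sum_congr rfl h, Finset.sum_const]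
      change coarseningNumber α F • _ - _ ∈ _
      -- At exact level `m` the terms cancel; above it, `F` already lies in the next layer.
      rcases hm.eq_or_lt with rfl | hlt
      · simp
      · exact sub_mem (nsmul_mem (single_mem_layer hF hlt) _)
          (nsmul_mem (single_mem_layer hF hlt) _)
    · obtain ⟨hf, hFf⟩ := Finset.mem_filter.1 hf
      rw [MonoidAlgebra.single_mul_single, mul_one]
      exact single_mem_layer (hF.mul (hweak f)) (Nat.succ_le_of_lt (hm.trans_lt
        (coarseningNumber_lt_mul hf hFf fun i j => (hG f i j).1)))

theorem mul_faceSum_sub_mem_layer {m : ℕ} {v : MonoidAlgebra k (LexRel n)}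
    (hv : v ∈ layer k α m) : v * faceSum k α - m • v ∈ layer k α (m + 1) :=
  mul_sum_sub_mem_layer LexRel.incomp_ofMap hv

theorem mul_faceSumRev_sub_mem_layer {m : ℕ} {v : MonoidAlgebra k (LexRel n)}
    (hv : v ∈ layer k α m) : v * faceSumRev k α - m • v ∈ layer k α (m + 1) :=
  mul_sum_sub_mem_layer
    (fun f i j => (LexRel.incomp_rev _ i j).trans (LexRel.incomp_ofMap f i j)) hv

theorem mul_faceSum_mem_layer {m : ℕ} {v : MonoidAlgebra k (LexRel n)}
    (hv : v ∈ layer k α m) : v * faceSum k α ∈ layer k α m := by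
  rw [← sub_add_cancel (v * faceSum k α) (m • v)]
  exact add_mem (layer_antitone (Nat.le_succ m) (mul_faceSum_sub_mem_layer hv)) (nsmul_mem hv m)

theorem mul_faceSumRev_mul_faceSum_sub_mem_layer {m : ℕ} {v : MonoidAlgebra k (LexRel n)}
    (hv : v ∈ layer k α m) :
    v * (faceSumRev k α * faceSum k α) - (m ^ 2) • v ∈ layer k α (m + 1) := by
  have h : v * (faceSumRev k α * faceSum k α) - (m ^ 2) • v =
      (v * faceSumRev k α - m • v) * faceSum k α + m • (v * faceSum k α - m • v) := by
    rw [sub_mul, mul_assoc, smul_mul_assoc, smul_sub, smul_smul, sq]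
    abel
  rw [h]
  exact add_mem (mul_faceSum_mem_layer (mul_faceSumRev_sub_mem_layer hv))
    (nsmul_mem (mul_faceSum_sub_mem_layer hv) m)

/-- Induction on the number `d` of levels left: the factor for `m` moves `v` one layer up, and a
level that is not a knapsack number is skipped for free. -/
theorem mul_aeval_eq_zero_of_mem_layer (d : ℕ) {m : ℕ}
    (hd : ∀ j ∈ knapsackNumbers α, j < m + d) {v : MonoidAlgebra k (LexRel n)}
    (hv : v ∈ layer k α m) :
    v * Polynomial.aeval (faceSumRev k α * faceSum k α)
      (∏ j ∈ (knapsackNumbers α).filter (m ≤ ·),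
        (Polynomial.X - Polynomial.C ((j : k) ^ 2))) = 0 := by
  induction d generalizing m v with
  | zero =>
    have hbot : layer k α m = ⊥ := layer_eq_bot hd
    rw [hbot, Submodule.mem_bot] at hv
    rw [hv, zero_mul]
  | succ d ih =>
    have hd' : ∀ j ∈ knapsackNumbers α, j < m + 1 + d := fun j hj => by
      have := hd j hj
      omega
    by_cases hm : m ∈ knapsackNumbers α
    · have hins : (knapsackNumbers α).filter (m ≤ ·) =
          insert m ((knapsackNumbers α).filter (m + 1 ≤ ·)) := by
        ext j
        simp only [Finset.mem_filter, Finset.mem_insert]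
        constructor
        · rintro ⟨hj, hmj⟩
          rcases hmj.eq_or_lt with h | h
          · exact Or.inl h.symm
          · exact Or.inr ⟨hj, h⟩
        · rintro (rfl | ⟨hj, hmj⟩)
          · exact ⟨hm, le_rfl⟩
          · exact ⟨hj, by omega⟩
      rw [hins, Finset.prod_insert (by simp), map_mul, ← mul_assoc]
      refine ih hd' ?_
      have h := mul_faceSumRev_mul_faceSum_sub_mem_layer hv
      convert h using 1
      rw [map_sub, Polynomial.aeval_X, Polynomial.aeval_C, mul_sub, ← Algebra.commutes,
        ← Algebra.smul_def, ← Nat.cast_smul_eq_nsmul k]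
      push_cast
      rfl
    · have hfil : (knapsackNumbers α).filter (m ≤ ·) =
          (knapsackNumbers α).filter (m + 1 ≤ ·) := by
        refine Finset.filter_congr fun j hj => ⟨fun h => ?_, fun h => by omega⟩
        exact Nat.succ_le_of_lt (lt_of_le_of_ne h fun e => hm (e ▸ hj))
      rw [hfil]
      rw [layer_succ_of_notMem hm] at hv
      exact ih hd' hv

theorem faceSum_mem_layer_one : faceSum k α ∈ layer k α 1 := by
  classical
  refine Submodule.sum_mem _ fun f hf => single_mem_layer (LexRel.isWeak_ofMap f) ?_
  exact Finset.card_pos.2 ⟨f, Finset.mem_filter.2 ⟨hf, fun i j => (LexRel.incomp_ofMap f i j).1⟩⟩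

/-- The product of the `x - m ^ 2` over the nonzero knapsack numbers `m`. -/
noncomputable def squareKnapsackPolynomial (k : Type*) [CommRing k] (α : Composition n) :
    Polynomial k :=
  ∏ m ∈ (knapsackNumbers α).filter (fun m => m ≠ 0), (Polynomial.X - Polynomial.C ((m : k) ^ 2))

theorem knapsackPolynomial_eq :
    knapsackPolynomial k α =
      Polynomial.expand k 2 (squareKnapsackPolynomial k α) * Polynomial.X := by
  have h : ∀ m : ℕ, Polynomial.expand k 2 (Polynomial.X - Polynomial.C ((m : k) ^ 2)) =
      (Polynomial.X + Polynomial.C (m : k)) * (Polynomial.X - Polynomial.C (m : k)) := fun m => by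
    rw [map_sub, Polynomial.expand_X, Polynomial.expand_C, Polynomial.C_pow]
    ring
  rw [knapsackPolynomial, squareKnapsackPolynomial, mul_comm, map_prod]
  simp only [h]

theorem faceSum_mul_aeval_eq_zero :
    faceSum k α * Polynomial.aeval (faceSumRev k α * faceSum k α)
      (squareKnapsackPolynomial k α) = 0 := by
  have hfil : (knapsackNumbers α).filter (fun m => m ≠ 0) = (knapsackNumbers α).filter (1 ≤ ·) :=
    Finset.filter_congr fun m _ => Nat.one_le_iff_ne_zero.symm
  obtain ⟨N, hN⟩ := (knapsackNumbers α).bddAbove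
  rw [squareKnapsackPolynomial, hfil]
  refine mul_aeval_eq_zero_of_mem_layer N (fun j hj => ?_) faceSum_mem_layer_one
  have : j ≤ N := hN hj
  omega

end FaceAlgebra

/-! ### Descent classes, block-increasing permutations and sorting. -/

theorem Composition.monotone_index {n : ℕ} (α : Composition n) : Monotone α.index := by
  intro p q hpq
  by_contra h
  rw [not_le] at h
  have h1 := α.sizeUpTo_index_le p
  have h2 := α.lt_sizeUpTo_index_succ q
  have h3 := α.monotone_sizeUpTo (Nat.succ_le_of_lt (Fin.lt_def.1 h))
  rw [Fin.val_succ] at h2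
  have h4 := Fin.le_def.1 hpq
  simp only [Nat.succ_eq_add_one] at h3
  omega

/-- A position `d` is a partial sum exactly when the adjacent indices `d - 1` and `d` lie in
different blocks. -/
theorem descentSet_subset_partialSums_iff {n : ℕ} (α : Composition n) (u : Equiv.Perm (Fin n)) :
    descentSet u ⊆ partialSums α ↔
      ∀ p q : Fin n, p < q → α.index p = α.index q → u p < u q := by
  constructor
  · intro h
    have step : ∀ p q : Fin n, (q : ℕ) = p + 1 → α.index p = α.index q → u p < u q := by
      intro p q hpq hidx
      by_contra hu
      have hne : u q ≠ u p := fun e => by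
        rw [u.injective e] at hpq
        omega
      have hmem : (q : ℕ) ∈ descentSet u := by
        refine Finset.mem_filter.2 ⟨Finset.mem_Icc.2 ⟨by omega, by omega⟩, p, q, hpq.symm, rfl, ?_⟩
        exact lt_of_le_of_ne (not_lt.1 hu) hne
      obtain ⟨c, -, hc⟩ := Finset.mem_image.1 (h hmem)
      have h1 := α.sizeUpTo_index_le p
      have h2 := α.lt_sizeUpTo_index_succ q
      rw [Fin.val_succ, ← hidx] at h2
      have h3 : ((α.index p : Fin _) : ℕ) < c :=
        α.monotone_sizeUpTo.reflect_lt (by omega)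
      have h4 := α.monotone_sizeUpTo (Nat.succ_le_of_lt h3)
      simp only [Nat.succ_eq_add_one] at h4
      omega
    -- Adjacent comparisons are chained; monotonicity of `α.index` keeps intermediate indices in the
    -- same block.
    have main : ∀ d : ℕ, ∀ p q : Fin n, (q : ℕ) = p + d + 1 → α.index p = α.index q →
        u p < u q := by
      intro d
      induction d with
      | zero => exact fun p q hpq => step p q hpq
      | succ d ih =>
        intro p q hpq hidx
        have hr : (p : ℕ) + d + 1 < n := by omega
        have hpr : p ≤ ⟨p + d + 1, hr⟩ := Fin.le_def.2 (by simp only; omega)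
        have hrq : (⟨p + d + 1, hr⟩ : Fin n) ≤ q := Fin.le_def.2 (by simp only; omega)
        have h1 : α.index p = α.index ⟨p + d + 1, hr⟩ :=
          le_antisymm (α.monotone_index hpr) (hidx ▸ α.monotone_index hrq)
        exact (ih p ⟨p + d + 1, hr⟩ rfl h1).trans
          (step ⟨p + d + 1, hr⟩ q (by simp only; omega) (h1 ▸ hidx))
    intro p q hpq
    have := Fin.lt_def.1 hpq
    exact main (q - p - 1) p q (by omega)
  · intro h d hd
    obtain ⟨-, i, j, hi, hj, hu⟩ := Finset.mem_filter.1 hd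
    have hij : i < j := Fin.lt_def.2 (by omega)
    have hlt : α.index i < α.index j := lt_of_le_of_ne (α.monotone_index hij.le)
      fun e => (h i j hij e).not_gt hu
    have hlt' := Fin.lt_def.1 hlt
    have h1 := α.sizeUpTo_index_le j
    have h2 := α.lt_sizeUpTo_index_succ i
    rw [Fin.val_succ] at h2
    have h3 := α.monotone_sizeUpTo (Nat.succ_le_of_lt hlt')
    simp only [Nat.succ_eq_add_one] at h3
    exact Finset.mem_image.2 ⟨α.index j, Finset.mem_Ico.2 ⟨by omega, (α.index j).2⟩, by omega⟩

theorem card_filter_index_eq {n : ℕ} (α : Composition n) (c : Fin α.length) :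
    (Finset.univ.filter fun i => α.index i = c).card = α.blocksFun c := by
  have : (Finset.univ.filter fun i => α.index i = c) =
      Finset.univ.map (α.embedding c).toEmbedding := by
    ext i
    simp only [Finset.mem_filter, Finset.mem_univ, true_and, Finset.mem_map]
    rw [eq_comm, ← α.mem_range_embedding_iff']
    rfl
  rw [this, Finset.card_map, Finset.card_univ, Fintype.card_fin]

theorem mem_typeMaps_iff {n : ℕ} {α : Composition n} {f : Fin n → Fin α.length} :
    f ∈ typeMaps α ↔ ∃ τ : Equiv.Perm (Fin n), f ∘ τ = α.index := by
  simp only [typeMaps, Finset.mem_filter, Finset.mem_univ, true_and]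
  constructor
  · intro h
    have e : ∀ c, Nonempty ({i // α.index i = c} ≃ {i // f i = c}) := fun c => by
      rw [← Fintype.card_eq, Fintype.card_subtype, Fintype.card_subtype, h,
        card_filter_index_eq]
    exact ⟨Equiv.ofFiberEquiv fun c => (e c).some, funext fun i => Equiv.ofFiberEquiv_map _ i⟩
  · rintro ⟨τ, hτ⟩ c
    rw [← card_filter_index_eq, ← hτ]
    refine (Finset.card_bij (fun i _ => τ i) ?_ ?_ ?_).symm
    · intro i hi
      simpa using hi
    · exact fun i _ j _ h => τ.injective h
    · exact fun i hi => ⟨τ.symm i, by simpa using hi, by simp⟩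

theorem comp_sort_eq_index {n : ℕ} {α : Composition n} {f : Fin n → Fin α.length}
    (hf : f ∈ typeMaps α) : f ∘ Tuple.sort f = α.index := by
  obtain ⟨τ, hτ⟩ := mem_typeMaps_iff.1 hf
  rw [← hτ]
  exact Tuple.unique_monotone (Tuple.monotone_sort f) (hτ ▸ α.monotone_index)

/-! ### Chambers: permutations as total orders. -/

/-- The strict total order on values in which `w 0, w 1, …` is increasing. -/
def LexRel.chamber {n : ℕ} (w : Equiv.Perm (Fin n)) : LexRel n := fun i j => w⁻¹ i < w⁻¹ j

theorem LexRel.chamber_injective {n : ℕ} :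
    Function.Injective (LexRel.chamber : Equiv.Perm (Fin n) → LexRel n) := by
  intro w u h
  have hmono : StrictMono (w⁻¹ * u : Equiv.Perm (Fin n)) := fun i j hij => by
    have : LexRel.chamber u (u i) (u j) := by
      simpa [LexRel.chamber] using hij
    rw [← h] at this
    exact this
  have h1 : w⁻¹ * u = 1 := by
    have h2 : (w⁻¹ * u) = Tuple.sort (id : Fin n → Fin n) := by
      rw [Tuple.eq_sort_iff]
      exact ⟨hmono.monotone, fun i j hij _ => hmono hij⟩
    rw [h2, Tuple.sort_eq_refl_iff_monotone.2 monotone_id]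
    rfl
  exact inv_mul_eq_one.1 h1

/-- The hypotheses say that `w * u` lists the values by their `f`-level, with ties in the order in
which `w` lists them; this is the lexicographic product. -/
theorem LexRel.chamber_mul {n m : ℕ} {f : Fin n → Fin m} {w u : Equiv.Perm (Fin n)}
    (hmono : Monotone (f ∘ (w * u)))
    (hu : ∀ p q, p < q → f ((w * u) p) = f ((w * u) q) → u p < u q) :
    LexRel.chamber (w * u) = LexRel.ofMap f * LexRel.chamber w := by
  have hw : ∀ p, w⁻¹ ((w * u) p) = u p := fun p => by simp
  have hwu : ∀ p, (w * u : Equiv.Perm (Fin n))⁻¹ ((w * u) p) = p := fun p => by simp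
  have key : ∀ p q, p < q → f ((w * u) p) < f ((w * u) q) ∨
      (f ((w * u) p) = f ((w * u) q) ∧ u p < u q) := fun p q hpq => by
    rcases (hmono hpq.le).lt_or_eq with h | h
    · exact Or.inl h
    · exact Or.inr ⟨h, hu p q hpq h⟩
  ext i j
  obtain ⟨p, rfl⟩ := (w * u).surjective i
  obtain ⟨q, rfl⟩ := (w * u).surjective j
  rw [LexRel.mul_apply]
  change (w * u)⁻¹ ((w * u) p) < (w * u)⁻¹ ((w * u) q) ↔ f ((w * u) p) < f ((w * u) q) ∨
    (¬ f ((w * u) q) < f ((w * u) p) ∧ w⁻¹ ((w * u) p) < w⁻¹ ((w * u) q))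
  rw [hw, hw, hwu, hwu]
  rcases lt_trichotomy p q with h | rfl | h
  · have := key p q h
    simp only [h, true_iff]
    rcases this with h' | ⟨h', h''⟩
    · exact Or.inl h'
    · exact Or.inr ⟨h'.not_gt, h''⟩
  · simp
  · have := key q p h
    simp only [h.not_gt, false_iff, not_or, not_and]
    rcases this with h' | ⟨h', h''⟩
    · exact ⟨h'.not_gt, fun h2 => absurd h' h2⟩
    · exact ⟨h'.not_gt, fun _ => h''.not_gt⟩

theorem LexRel.rev_chamber {n : ℕ} (w : Equiv.Perm (Fin n)) :
    LexRel.rev (LexRel.chamber w) = LexRel.chamber (w * Fin.revPerm) := by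
  ext i j
  rw [LexRel.rev_apply]
  have h : ∀ x, (w * Fin.revPerm : Equiv.Perm (Fin n))⁻¹ x = Fin.rev (w⁻¹ x) := fun x => by
    rw [mul_inv_rev]
    rfl
  simp only [LexRel.chamber, h, Fin.rev_lt_rev]

/-! ### Transport from the face algebra to the group algebra. -/

section Transport

variable {k : Type*} [CommRing k] {n : ℕ} {α : Composition n}

/-- The linear embedding of the group algebra sending a permutation to its chamber. -/
noncomputable def chamberMap (k : Type*) [CommRing k] (n : ℕ) :
    MonoidAlgebra k (Equiv.Perm (Fin n)) →ₗ[k] MonoidAlgebra k (LexRel n) :=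
  MonoidAlgebra.mapDomainLinearMap k k LexRel.chamber

theorem chamberMap_single (w : Equiv.Perm (Fin n)) (c : k) :
    chamberMap k n (MonoidAlgebra.single w c) = MonoidAlgebra.single (LexRel.chamber w) c :=
  MonoidAlgebra.mapDomainLinearMap_single _ _ _

theorem chamberMap_injective : Function.Injective (chamberMap k n) :=
  MonoidAlgebra.mapDomain_injective LexRel.chamber_injective

/-- The algebra endomorphism induced by reversal of relations. -/
noncomputable def revAlgHom (k : Type*) [CommRing k] (n : ℕ) :
    MonoidAlgebra k (LexRel n) →ₐ[k] MonoidAlgebra k (LexRel n) :=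
  MonoidAlgebra.mapDomainAlgHom k k LexRel.rev

theorem revAlgHom_single (F : LexRel n) (c : k) :
    revAlgHom k n (MonoidAlgebra.single F c) = MonoidAlgebra.single (LexRel.rev F) c :=
  MonoidAlgebra.mapDomain_single

theorem revAlgHom_faceSum : revAlgHom k n (faceSum k α) = faceSumRev k α := by
  rw [faceSum, map_sum]
  exact Finset.sum_congr rfl fun f _ => revAlgHom_single _ _

theorem revAlgHom_faceSumRev : revAlgHom k n (faceSumRev k α) = faceSum k α := by
  rw [faceSumRev, map_sum]
  exact Finset.sum_congr rfl fun f _ => revAlgHom_single _ _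

theorem chamberMap_mul_longestElement (y : MonoidAlgebra k (Equiv.Perm (Fin n))) :
    chamberMap k n (y * longestElement k n) = revAlgHom k n (chamberMap k n y) := by
  induction y using MonoidAlgebra.induction_linear with
  | zero => simp
  | add x y hx hy => rw [add_mul, map_add, hx, hy, map_add, map_add]
  | single w c =>
    rw [longestElement, MonoidAlgebra.of_apply, MonoidAlgebra.single_mul_single, mul_one,
      chamberMap_single, chamberMap_single, revAlgHom_single, LexRel.rev_chamber]

/-- For fixed `w`, stable sorting of `f ∘ w` matches the faces `f` of type `α` with the permutations
`u` that increase on the blocks of `α`. -/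
theorem chamberMap_mul_compositionB (y : MonoidAlgebra k (Equiv.Perm (Fin n))) :
    chamberMap k n (y * compositionB k α) = faceSum k α * chamberMap k n y := by
  induction y using MonoidAlgebra.induction_linear with
  | zero => simp
  | add x y hx hy => rw [add_mul, map_add, hx, hy, map_add, mul_add]
  | single w c =>
    rw [compositionB, descentB, Finset.mul_sum, map_sum, chamberMap_single, faceSum,
      Finset.sum_mul]
    simp only [MonoidAlgebra.of_apply, MonoidAlgebra.single_mul_single, mul_one, one_mul,
      chamberMap_single]
    have hsort : ∀ f ∈ typeMaps α, (f ∘ w) ∘ Tuple.sort (f ∘ w) = α.index := fun f hf => by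
      refine comp_sort_eq_index (mem_typeMaps_iff.2 ?_)
      obtain ⟨τ, hτ⟩ := mem_typeMaps_iff.1 hf
      exact ⟨w⁻¹ * τ, by rw [← hτ]; ext i; simp⟩
    symm
    refine Finset.sum_bij (fun f _ => Tuple.sort (f ∘ w)) ?_ ?_ ?_ ?_
    · intro f hf
      rw [Finset.mem_filter, descentSet_subset_partialSums_iff]
      refine ⟨Finset.mem_univ _, fun p q hpq h => ?_⟩
      rw [← hsort f hf] at h
      exact (Tuple.eq_sort_iff.1 rfl).2 p q hpq h
    · intro f hf g hg h
      have h1 := hsort f hf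
      rw [h, ← hsort g hg] at h1
      funext i
      have := congrFun h1 ((Tuple.sort (g ∘ w))⁻¹ (w⁻¹ i))
      simpa using this
    · intro u hu
      rw [Finset.mem_filter, descentSet_subset_partialSums_iff] at hu
      -- The face that gives `u` sends the value at position `p` of `w * u` to the block of `p`.
      obtain ⟨v, hv⟩ : ∃ v : Equiv.Perm (Fin n), v = (w * u)⁻¹ := ⟨_, rfl⟩
      have hfu : ∀ i, (α.index ∘ v ∘ w) (u i) = α.index i := fun i =>
        congrArg α.index (show (v * (w * u)) i = i by rw [hv, inv_mul_cancel]; rfl)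
      have hf : (α.index ∘ v) ∘ (w * u : Equiv.Perm (Fin n)) = α.index := funext hfu
      refine ⟨α.index ∘ v, mem_typeMaps_iff.2 ⟨w * u, hf⟩, ?_⟩
      symm
      rw [Tuple.eq_sort_iff]
      refine ⟨hf.symm ▸ α.monotone_index, fun i j hij h => hu.2 i j hij ?_⟩
      rw [← hfu i, ← hfu j]
      exact h
    · intro f hf
      rw [LexRel.chamber_mul]
      · exact (hsort f hf).symm ▸ α.monotone_index
      · exact (Tuple.eq_sort_iff (f := f ∘ w).1 rfl).2

theorem chamberMap_mul_mul (y : MonoidAlgebra k (Equiv.Perm (Fin n))) :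
    chamberMap k n (y * (longestElement k n * compositionB k α)) =
      faceSum k α * revAlgHom k n (chamberMap k n y) := by
  rw [← mul_assoc, chamberMap_mul_compositionB, chamberMap_mul_longestElement]

theorem revAlgHom_revAlgHom (x : MonoidAlgebra k (LexRel n)) :
    revAlgHom k n (revAlgHom k n x) = x := by
  induction x using MonoidAlgebra.induction_linear with
  | zero => simp
  | add x y hx hy => rw [map_add, map_add, hx, hy]
  | single F c =>
    rw [revAlgHom_single, revAlgHom_single]
    rfl

theorem chamberMap_mul_sq (y : MonoidAlgebra k (Equiv.Perm (Fin n))) :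
    chamberMap k n (y * (longestElement k n * compositionB k α) ^ 2) =
      faceSum k α * faceSumRev k α * chamberMap k n y := by
  rw [sq, ← mul_assoc, chamberMap_mul_mul, chamberMap_mul_mul, map_mul, revAlgHom_faceSum,
    revAlgHom_revAlgHom, mul_assoc]

theorem map_mul_aeval {R A B : Type*} [CommRing R] [Ring A] [Ring B] [Algebra R A] [Algebra R B]
    (φ : A →ₗ[R] B) {a : A} {b : B} (h : ∀ y, φ (y * a) = b * φ y) (y : A) (q : Polynomial R) :
    φ (y * Polynomial.aeval a q) = Polynomial.aeval b q * φ y := by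
  have hpow : ∀ m, φ (y * a ^ m) = b ^ m * φ y := fun m => by
    induction m with
    | zero => simp
    | succ m ih => rw [pow_succ, ← mul_assoc, h, ih, ← mul_assoc, ← pow_succ']
  induction q using Polynomial.induction_on' with
  | add p q hp hq => rw [map_add, mul_add, map_add, hp, hq, map_add, add_mul]
  | monomial m c =>
    rw [Polynomial.aeval_monomial, Polynomial.aeval_monomial, ← Algebra.smul_def,
      ← Algebra.smul_def, mul_smul_comm, map_smul, hpow, smul_mul_assoc]

/-- The factor `x` contributes `B` and one reversal, which turns `Q(BB')` into `Q(B'B)`. -/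
theorem aeval_knapsackPolynomial_eq_zero :
    Polynomial.aeval (longestElement k n * compositionB k α) (knapsackPolynomial k α) = 0 := by
  apply chamberMap_injective
  rw [knapsackPolynomial_eq, map_mul, Polynomial.aeval_X, Polynomial.expand_aeval,
    chamberMap_mul_mul, ← one_mul (Polynomial.aeval _ _),
    map_mul_aeval (chamberMap k n) chamberMap_mul_sq, map_mul,
    ← Polynomial.aeval_algHom_apply, map_mul, revAlgHom_faceSum, revAlgHom_faceSumRev,
    ← mul_assoc, faceSum_mul_aeval_eq_zero, zero_mul, map_zero]

end Transport

/-! ### Membership in the descent algebra. -/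

theorem descentSet_subset_Icc {n : ℕ} (w : Equiv.Perm (Fin n)) :
    descentSet w ⊆ Finset.Icc 1 (n - 1) :=
  Finset.filter_subset _ _

theorem mem_descentSet_revPerm_mul {n : ℕ} (w : Equiv.Perm (Fin n)) (d : ℕ) :
    d ∈ descentSet (Fin.revPerm * w) ↔ d ∈ Finset.Icc 1 (n - 1) ∧ d ∉ descentSet w := by
  simp only [descentSet, Finset.mem_filter, Equiv.Perm.mul_apply, Fin.revPerm_apply,
    Fin.rev_lt_rev]
  refine and_congr_right fun hd => ?_
  simp only [hd, true_and]
  rw [Finset.mem_Icc] at hd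
  constructor
  · rintro ⟨i, j, hi, hj, h⟩ ⟨i', j', hi', hj', h'⟩
    obtain rfl : i = i' := Fin.ext (by omega)
    obtain rfl : j = j' := Fin.ext (by omega)
    exact h.not_gt h'
  · intro h
    let i : Fin n := ⟨d - 1, by omega⟩
    let j : Fin n := ⟨d, by omega⟩
    have hi : (i : ℕ) + 1 = d := Nat.sub_add_cancel hd.1
    refine ⟨i, j, hi, rfl, lt_of_le_of_ne (not_lt.1 fun h' => h ⟨i, j, hi, rfl, h'⟩) fun e => ?_⟩
    have hij : (i : ℕ) = j := congrArg Fin.val (w.injective e)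
    change (i : ℕ) = d at hij
    omega

theorem sum_descentSet_between_mem_descentAlgebra {k : Type*} [CommRing k] {n : ℕ}
    (P : Finset ℕ) {J : Finset ℕ} (hJ : J ⊆ Finset.Icc 1 (n - 1)) :
    ∑ w ∈ Finset.univ.filter (fun w : Equiv.Perm (Fin n) =>
      descentSet w ⊆ J ∧ P ⊆ descentSet w), MonoidAlgebra.of k (Equiv.Perm (Fin n)) w ∈
        descentAlgebra k n := by
  induction P using Finset.induction_on generalizing J with
  | empty =>
    simp only [Finset.empty_subset, and_true]
    exact Submodule.subset_span ⟨J, hJ, rfl⟩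
  | insert p P _ ih =>
    -- Requiring the descent `p` amounts to subtracting the permutations that lack it, whose descent
    -- sets lie in `J.erase p`.
    have h := sub_mem (ih hJ) (ih ((Finset.erase_subset p J).trans hJ))
    convert h using 1
    rw [eq_sub_iff_add_eq, ← Finset.sum_filter_add_sum_filter_not (Finset.univ.filter
      fun w : Equiv.Perm (Fin n) => descentSet w ⊆ J ∧ P ⊆ descentSet w)
      (fun w => p ∈ descentSet w), Finset.filter_filter, Finset.filter_filter]
    congr 1
    · refine Finset.sum_congr (Finset.filter_congr fun w _ => ?_) fun _ _ => rfl
      rw [Finset.insert_subset_iff]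
      tauto
    · refine Finset.sum_congr (Finset.filter_congr fun w _ => ?_) fun _ _ => rfl
      rw [Finset.subset_erase]
      tauto

/-- Left multiplication by `w₀` complements descent sets, so an upper bound `I` becomes the lower
bound given by the complement of `I`. -/
theorem longestElement_mul_descentB_mem_descentAlgebra {k : Type*} [CommRing k] {n : ℕ}
    (I : Finset ℕ) :
    longestElement k n * descentB k n I ∈ descentAlgebra k n := by
  convert sum_descentSet_between_mem_descentAlgebra (k := k) (Finset.Icc 1 (n - 1) \ I)
    (Finset.Subset.refl (Finset.Icc 1 (n - 1))) using 1
  rw [longestElement, descentB, Finset.mul_sum]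
  simp only [← map_mul]
  have hrev : ∀ w : Equiv.Perm (Fin n), Fin.revPerm * (Fin.revPerm * w) = w := fun w => by
    ext i
    simp
  have hdes : ∀ w : Equiv.Perm (Fin n), descentSet w ⊆ I ↔
      Finset.Icc 1 (n - 1) \ I ⊆ descentSet (Fin.revPerm * w) := fun w => by
    constructor
    · intro h d hd
      rw [Finset.mem_sdiff] at hd
      exact (mem_descentSet_revPerm_mul w d).2 ⟨hd.1, fun h' => hd.2 (h h')⟩
    · intro h d hd
      by_contra hdI
      exact ((mem_descentSet_revPerm_mul w d).1
        (h (Finset.mem_sdiff.2 ⟨descentSet_subset_Icc w hd, hdI⟩))).2 hd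
  refine Finset.sum_bij' (fun w _ => Fin.revPerm * w) (fun w _ => Fin.revPerm * w) ?_ ?_
    (fun w _ => hrev w) (fun w _ => hrev w) (fun _ _ => rfl)
  · intro w hw
    exact Finset.mem_filter.2 ⟨Finset.mem_univ _, descentSet_subset_Icc _,
      (hdes w).1 (Finset.mem_filter.1 hw).2⟩
  · intro w hw
    refine Finset.mem_filter.2 ⟨Finset.mem_univ _, (hdes _).2 ?_⟩
    rw [hrev]
    exact (Finset.mem_filter.1 hw).2.2

theorem mainTheorem9 {k : Type*} [CommRing k] (n : ℕ) (α : Composition n) :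
    longestElement k n * compositionB k α ∈ descentAlgebra k n ∧
      Polynomial.aeval (longestElement k n * compositionB k α) (knapsackPolynomial k α) = 0 :=
  ⟨longestElement_mul_descentB_mem_descentAlgebra _,
    aeval_knapsackPolynomial_eq_zero⟩
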